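/- Conventions. For $n\ge 0$, let $\operatorname{Tam}_n$ be the set of planar rooted binary trees with $n$ (trivalent) vertices, hence $n+1$ leaves, labelled $1,\dots,n+1$ from left to right. It is partially ordered by the Tamari order, the reflexive transitive closure of the rotations that replace, at some vertex of a tree, a configuration $(A\,B)\,C$ by $A\,(B\,C)$ (the tree after the replacement being the larger one). For $T\in\operatorname{Tam}_k$, $S\in\operatorname{Tam}_m$ and $1\le i\le k+1$, let $T\circ_i S\in\operatorname{Tam}_{k+m}$ be the tree obtained by grafting the root of $S$ on the $i$-th leaf of $T$. An interval $[S,T]$ (with $S\le T$) of $\operatorname{Tam}_n$ is called *new* if it is not the grafting of two intervals, that is, if there are no $k,m\ge 1$, intervals $[S_1,T_1]$ of $\operatorname{Tam}_k$ and $[S_2,T_2]$ of $\operatorname{Tam}_m$, and $1\le i\le k+1$ such that $S=S_1\circ_i S_2$ and $T=T_1\circ_i T_2$. An *interval-poset* of size $n$ is a partial order $\lhd$ on $\{1,\dots,n\}$ such that for all integers $a<b<c$ in $\{1,\dots,n\}$: if $a\lhd c$ then $b\lhd c$, and if $c\lhd a$ then $b\lhd a$. It is called *modern* if there are no $x<y<z$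 with $x\lhd y$ and $z\lhd y$. **Corollary.** Let $n\ge 0$ be an integer. There is a bijection between the set of new intervals of $\operatorname{Tam}_{n+1}$ and the set of modern interval-posets of size $n$. -/

import Mathlib

namespace TamariNew

/-- Planar binary trees: `nil` is the tree reduced to one leaf, and the trivalent vertices
are the nodes. The size is `BinaryTree.numNodes`. -/
abbrev PTree : Type := BinaryTree Unit

/-- `Rotation T S`: the tree `S` is obtained from `T` by replacing one configuration
`(A B) C`, at some vertex of `T`, by the configuration `A (B C)`. -/
inductive Rotation : PTree → PTree → Prop
  | root (A B C : PTree) :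
      Rotation (.node () (.node () A B) C) (.node () A (.node () B C))
  | left {L L' : PTree} (R : PTree) :
      Rotation L L' → Rotation (.node () L R) (.node () L' R)
  | right (L : PTree) {R R' : PTree} :
      Rotation R R' → Rotation (.node () L R) (.node () L R')

/-- The set of binary trees with `n` vertices. -/
def Tam (n : ℕ) : Type := {T : PTree // T.numNodes = n}

/-- The underlying binary tree. -/
def Tam.tree {n : ℕ} (T : Tam n) : PTree := T.1

/-- A statistic that increases under rotation (used for the antisymmetry of the order only). -/
def weight : PTree → ℕ
  | .nil => 0
  | .node _ L R => weight L + weight R + R.numNodes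

theorem Rotation.numNodes_eq {T S : PTree} (h : Rotation T S) : T.numNodes = S.numNodes := by
  induction h with
  | root A B C => simp only [BinaryTree.numNodes]; omega
  | left R _ ih => simp only [BinaryTree.numNodes]; omega
  | right L _ ih => simp only [BinaryTree.numNodes]; omega

theorem Rotation.weight_lt {T S : PTree} (h : Rotation T S) : weight T < weight S := by
  induction h with
  | root A B C => simp only [weight, BinaryTree.numNodes]; omega
  | left R _ ih => simp only [weight]; omega
  | right L h ih => have := h.numNodes_eq; simp only [weight]; omega

theorem eq_or_weight_lt {T S : PTree} (h : Relation.ReflTransGen Rotation T S) :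
    T = S ∨ weight T < weight S := by
  induction h with
  | refl => exact Or.inl rfl
  | tail _ hbc ih =>
    have := hbc.weight_lt
    rcases ih with rfl | ih
    · exact Or.inr this
    · exact Or.inr (ih.trans this)

/-- The Tamari order: the reflexive transitive closure of the rotations. -/
instance (n : ℕ) : PartialOrder (Tam n) where
  le T S := Relation.ReflTransGen Rotation T.tree S.tree
  le_refl _ := Relation.ReflTransGen.refl
  le_trans _ _ _ h₁ h₂ := Relation.ReflTransGen.trans h₁ h₂
  le_antisymm T S h₁ h₂ := by
    apply Subtype.ext
    rcases eq_or_weight_lt h₁ with h | h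
    · exact h
    · rcases eq_or_weight_lt h₂ with h' | h'
      · exact h'.symm
      · omega

/-- `graft T i S` is the tree obtained by grafting the root of `S` on the `i`-th leaf of `T`, the
leaves being labelled `1, 2, …` from left to right. It is only used for
`1 ≤ i ≤ T.numNodes + 1`, the number of leaves of `T` being `T.numNodes + 1`. -/
def graft : PTree → ℕ → PTree → PTree
  | .nil, _, S => S
  | .node _ L R, i, S =>
      if i ≤ L.numNodes + 1 then .node () (graft L i S) R
      else .node () L (graft R (i - (L.numNodes + 1)) S)

/-- The interval `I = [S, T]` is the `i`-th grafting of the interval `K = [S₂, T₂]` on the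
interval `J = [S₁, T₁]`: one has `S = S₁ ∘ᵢ S₂` and `T = T₁ ∘ᵢ T₂`. -/
def IsGrafting {n k m : ℕ} (I : NonemptyInterval (Tam n)) (J : NonemptyInterval (Tam k))
    (i : ℕ) (K : NonemptyInterval (Tam m)) : Prop :=
  I.fst.tree = graft J.fst.tree i K.fst.tree ∧ I.snd.tree = graft J.snd.tree i K.snd.tree

/-- An interval of a Tamari lattice is new if it is not the grafting of two intervals. Both
intervals have size at least `1`: grafting the tree without vertices, or grafting onto it, does
nothing. -/
def IsNew {n : ℕ} (I : NonemptyInterval (Tam n)) : Prop :=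
  ¬ ∃ (k m : ℕ) (J : NonemptyInterval (Tam k)) (K : NonemptyInterval (Tam m)) (i : ℕ),
      1 ≤ k ∧ 1 ≤ m ∧ 1 ≤ i ∧ i ≤ k + 1 ∧ IsGrafting I J i K

/-- Interval-posets of size `n`; the integer `a ∈ {1, …, n}` is the element of `Fin n` with value
`a - 1`, and `<` is the usual order of the integers. -/
@[ext]
structure IntervalPoset (n : ℕ) where
  /-- the relation `◁` -/
  rel : Fin n → Fin n → Prop
  rel_refl : ∀ a, rel a a
  rel_antisymm : ∀ a b, rel a b → rel b a → a = b
  rel_trans : ∀ a b c, rel a b → rel b c → rel a c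
  inc_condition : ∀ a b c, a < b → b < c → rel a c → rel b c
  dec_condition : ∀ a b c, a < b → b < c → rel c a → rel b a

/-- An interval-poset is modern if it has no configuration `x ◁ y`, `z ◁ y` with `x < y < z`. -/
def IntervalPoset.IsModern {n : ℕ} (P : IntervalPoset n) : Prop :=
  ¬ ∃ x y z : Fin n, x < y ∧ y < z ∧ P.rel x y ∧ P.rel z y

end TamariNew

namespace TamariNew

/-! Label the vertices of a tree in infix order from `0`. A tree is encoded by its right-subtree
pairs `Dec`, and equally by its left-subtree pairs `Inc`. Each family is exactly the set of
transitive relations on increasing pairs with a one-sided convexity. Moreover `S ≤ T` holds iff `Dec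
S` and `Inc T` are disjoint (`reflTransGen_iff_compat`), so an interval is a pair of such relations
subject to disjointness.

A grafted subtree occupies a block of consecutive labels. In an interval, such a block is detected
by `Dec S` at its left neighbour and `Inc T` at its right neighbour. Newness therefore says
(`isNew_iff`) that `Dec S` avoids the last label, `Inc T` avoids `0`, and `Dec S` is disjoint from
`Inc T` shifted down by one.

Thus `Dec S` and the shifted `Inc T` both live on `n` labels, and serve as the decreasing and
increasing relations of an interval-poset. The shift exchanges two conditions: newness becomes
antisymmetry, and `S ≤ T` becomes modernity. Reading this backwards, with trees rebuilt by
`exists_tree_dec` and `exists_tree_inc`, gives surjectivity. -/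

open Relation

/-! ### Left and right subtree relations of a binary tree -/

/-- In the infix labelling by `0, 1, …`, the vertex `j` lies in the right subtree of `i`. -/
def Dec : PTree → ℕ → ℕ → Prop
  | .nil, _, _ => False
  | .node _ L R, i, j => Dec L i j ∨
      (i = L.numNodes ∧ L.numNodes < j ∧ j ≤ L.numNodes + R.numNodes) ∨
      (L.numNodes < i ∧ L.numNodes < j ∧ Dec R (i - (L.numNodes + 1)) (j - (L.numNodes + 1)))

/-- In the infix labelling by `0, 1, …`, the vertex `i` lies in the left subtree of `j`. -/
def Inc : PTree → ℕ → ℕ → Prop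
  | .nil, _, _ => False
  | .node _ L R, i, j => Inc L i j ∨ (i < L.numNodes ∧ j = L.numNodes) ∨
      (L.numNodes < i ∧ L.numNodes < j ∧ Inc R (i - (L.numNodes + 1)) (j - (L.numNodes + 1)))

theorem numNodes_node (L R : PTree) :
    BinaryTree.numNodes (.node () L R) = L.numNodes + R.numNodes + 1 := rfl

theorem Dec.bounds {T : PTree} {i j : ℕ} (h : Dec T i j) : i < j ∧ j < T.numNodes := by
  induction T generalizing i j with
  | nil => exact h.elim
  | node _ L R ihL ihR =>
    rw [numNodes_node]
    rcases h with h | h | ⟨h₁, h₂, h⟩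
    · have := ihL h; omega
    · omega
    · have := ihR h; omega

theorem Inc.bounds {T : PTree} {i j : ℕ} (h : Inc T i j) : i < j ∧ j < T.numNodes := by
  induction T generalizing i j with
  | nil => exact h.elim
  | node _ L R ihL ihR =>
    rw [numNodes_node]
    rcases h with h | h | ⟨h₁, h₂, h⟩
    · have := ihL h; omega
    · omega
    · have := ihR h; omega

section node

variable {L R : PTree} {i j : ℕ}

theorem dec_node_of_lt (h : i < L.numNodes) : Dec (.node () L R) i j ↔ Dec L i j := by
  simp only [Dec]
  constructor
  · rintro (h | h | h)
    · exact h
    · omega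
    · omega
  · exact Or.inl

theorem dec_node_root :
    Dec (.node () L R) L.numNodes j ↔ L.numNodes < j ∧ j ≤ L.numNodes + R.numNodes := by
  simp only [Dec]
  constructor
  · rintro (h | h | h)
    · have := h.bounds; omega
    · exact h.2
    · omega
  · intro h; exact Or.inr (Or.inl ⟨trivial, h⟩)

theorem dec_node_add :
    Dec (.node () L R) (L.numNodes + 1 + i) (L.numNodes + 1 + j) ↔ Dec R i j := by
  simp only [Dec, Nat.add_sub_cancel_left]
  constructor
  · rintro (h | h | h)
    · have := h.bounds; omega
    · omega
    · exact h.2.2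
  · intro h; exact Or.inr (Or.inr ⟨by omega, by omega, h⟩)

theorem inc_node_of_lt (h : j < L.numNodes) : Inc (.node () L R) i j ↔ Inc L i j := by
  simp only [Inc]
  constructor
  · rintro (h | h | h)
    · exact h
    · omega
    · omega
  · exact Or.inl

theorem inc_node_root : Inc (.node () L R) i L.numNodes ↔ i < L.numNodes := by
  simp only [Inc]
  constructor
  · rintro (h | h | h)
    · have := h.bounds; omega
    · exact h.1
    · omega
  · intro h; exact Or.inr (Or.inl ⟨h, trivial⟩)

theorem inc_node_add :
    Inc (.node () L R) (L.numNodes + 1 + i) (L.numNodes + 1 + j) ↔ Inc R i j := by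
  simp only [Inc, Nat.add_sub_cancel_left]
  constructor
  · rintro (h | h | h)
    · have := h.bounds; omega
    · omega
    · exact h.2.2
  · intro h; exact Or.inr (Or.inr ⟨by omega, by omega, h⟩)

end node

theorem Dec.trans {T : PTree} {i j k : ℕ} (h : Dec T i j) (h' : Dec T j k) : Dec T i k := by
  induction T generalizing i j k with
  | nil => exact h.elim
  | node _ L R ihL ihR =>
    have hk := h'.bounds
    rw [numNodes_node] at hk
    rcases h with h | h | ⟨h₁, h₂, h⟩
    · have := h.bounds
      rw [dec_node_of_lt (by omega)] at h'
      exact Or.inl (ihL h h')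
    · obtain ⟨rfl, h⟩ := h
      exact dec_node_root.2 ⟨by omega, by omega⟩
    · rcases h' with h' | h' | ⟨-, h₃, h'⟩
      · have := h'.bounds; omega
      · omega
      · exact Or.inr (Or.inr ⟨h₁, h₃, ihR h h'⟩)

theorem Inc.trans {T : PTree} {i j k : ℕ} (h : Inc T i j) (h' : Inc T j k) : Inc T i k := by
  induction T generalizing i j k with
  | nil => exact h.elim
  | node _ L R ihL ihR =>
    have hi := h.bounds
    rcases h' with h' | h' | ⟨h₂, h₃, h'⟩
    · have := h'.bounds
      rw [inc_node_of_lt (by omega)] at h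
      exact Or.inl (ihL h h')
    · obtain ⟨h', rfl⟩ := h'
      exact inc_node_root.2 (by omega)
    · rcases h with h | h | ⟨h₁, -, h⟩
      · have := h.bounds; omega
      · omega
      · exact Or.inr (Or.inr ⟨h₁, h₃, ihR h h'⟩)

theorem Dec.of_le {T : PTree} {i j k : ℕ} (h : Dec T i k) (hij : i < j) (hjk : j ≤ k) :
    Dec T i j := by
  induction T generalizing i j k with
  | nil => exact h.elim
  | node _ L R ihL ihR =>
    rcases h with h | h | ⟨h₁, h₂, h⟩
    · exact Or.inl (ihL h hij hjk)
    · exact Or.inr (Or.inl ⟨h.1, by omega, by omega⟩)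
    · exact Or.inr (Or.inr ⟨h₁, by omega, ihR h (by omega) (by omega)⟩)

theorem Inc.of_le {T : PTree} {i j k : ℕ} (h : Inc T i k) (hij : i ≤ j) (hjk : j < k) :
    Inc T j k := by
  induction T generalizing i j k with
  | nil => exact h.elim
  | node _ L R ihL ihR =>
    rcases h with h | h | ⟨h₁, h₂, h⟩
    · exact Or.inl (ihL h hij hjk)
    · exact Or.inr (Or.inl ⟨by omega, h.2⟩)
    · exact Or.inr (Or.inr ⟨by omega, h₂, ihR h (by omega) (by omega)⟩)

/-! ### The Tamari order as disjointness of `Dec` and `Inc` -/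

/-- No pair of vertices is related both by the right subtrees of `S` and by the left subtrees
of `T`. -/
def Compat (S T : PTree) : Prop := ∀ i j, Dec S i j → ¬ Inc T i j

theorem compat_self (T : PTree) : Compat T T := by
  intro i j h h'
  induction T generalizing i j with
  | nil => exact h
  | node _ L R ihL ihR =>
    rcases h with h | h | ⟨h₁, h₂, h⟩
    · have := h.bounds
      exact ihL i j h ((inc_node_of_lt (by omega)).1 h')
    · rcases h' with h' | h' | h'
      · have := h'.bounds; omega
      · omega
      · omega
    · rcases h' with h' | h' | h'
      · have := h'.bounds; omega
      · omega
      · exact ihR _ _ h h'.2.2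

theorem Rotation.dec {S T : PTree} (h : Rotation S T) {i j : ℕ} (hd : Dec S i j) :
    Dec T i j := by
  induction h generalizing i j with
  | root A B C =>
    rcases hd with (hd | hd | ⟨h₁, h₂, hd⟩) | hd | ⟨h₁, h₂, hd⟩
    · exact Or.inl hd
    · refine Or.inr (Or.inl ⟨hd.1, hd.2.1, ?_⟩)
      rw [numNodes_node]; omega
    · exact Or.inr (Or.inr ⟨h₁, h₂, Or.inl hd⟩)
    · simp only [numNodes_node] at hd
      exact Or.inr (Or.inr ⟨by omega, by omega, Or.inr (Or.inl ⟨by omega, by omega, by omega⟩)⟩)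
    · simp only [numNodes_node] at h₁ h₂ hd
      refine Or.inr (Or.inr ⟨by omega, by omega, Or.inr (Or.inr ⟨by omega, by omega, ?_⟩)⟩)
      convert hd using 1 <;> omega
  | left R h ih =>
    have := h.numNodes_eq
    rcases hd with hd | hd | hd
    · exact Or.inl (ih hd)
    · rw [this] at hd; exact Or.inr (Or.inl hd)
    · rw [this] at hd; exact Or.inr (Or.inr hd)
  | right L h ih =>
    have := h.numNodes_eq
    rcases hd with hd | hd | hd
    · exact Or.inl hd
    · rw [this] at hd; exact Or.inr (Or.inl hd)
    · exact Or.inr (Or.inr ⟨hd.1, hd.2.1, ih hd.2.2⟩)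

theorem dec_mono {S T : PTree} (h : ReflTransGen Rotation S T) {i j : ℕ} (hd : Dec S i j) :
    Dec T i j := by
  induction h with
  | refl => exact hd
  | tail _ h ih => exact h.dec ih

theorem numNodes_eq_of_reflTransGen {S T : PTree} (h : ReflTransGen Rotation S T) :
    S.numNodes = T.numNodes := by
  induction h with
  | refl => rfl
  | tail _ h ih => exact ih.trans h.numNodes_eq

theorem reflTransGen_node {L L' R R' : PTree} (hL : ReflTransGen Rotation L L')
    (hR : ReflTransGen Rotation R R') :
    ReflTransGen Rotation (.node () L R) (.node () L' R') :=
  (hL.lift (fun X => BinaryTree.node () X R) fun _ _ h => Rotation.left R h).trans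
    (hR.lift (fun X => BinaryTree.node () L' X) fun _ _ h => Rotation.right L' h)

/-- A vertex that lies in no right subtree can be brought to the root. -/
theorem exists_le_node (S : PTree) (c : ℕ) (hc : c < S.numNodes) (h : ∀ i, ¬ Dec S i c) :
    ∃ A B : PTree, A.numNodes = c ∧ ReflTransGen Rotation S (.node () A B) ∧
      (∀ i j, Dec A i j → Dec S i j) ∧ ∀ i j, Dec B i j → Dec S (c + 1 + i) (c + 1 + j) := by
  induction S generalizing c with
  | nil => exact absurd hc (Nat.not_lt_zero _)
  | node _ L R ihL _ =>
    rw [numNodes_node] at hc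
    rcases lt_trichotomy c L.numNodes with hl | rfl | hl
    · obtain ⟨A, B, hA, hr, hdA, hdB⟩ := ihL c hl fun i hi => h i (Or.inl hi)
      have hn := numNodes_eq_of_reflTransGen hr
      rw [numNodes_node] at hn
      -- Rotating `(A B) R` to `A (B R)` enlarges only the right subtree of `c`, now the root, so
      -- nothing new appears inside the two branches.
      refine ⟨A, .node () B R, hA, (reflTransGen_node hr .refl).tail (.root A B R),
        fun i j hd => Or.inl (hdA i j hd), ?_⟩
      rintro i j (hd | hd | ⟨h₁, h₂, hd⟩)
      · exact Or.inl (hdB i j hd)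
      · exact Or.inr (Or.inl ⟨by omega, by omega, by omega⟩)
      · refine Or.inr (Or.inr ⟨by omega, by omega, ?_⟩)
        convert hd using 1 <;> omega
    · exact ⟨L, R, rfl, .refl, fun i j hd => Or.inl hd, fun i j hd => dec_node_add.2 hd⟩
    · exact absurd (dec_node_root.2 ⟨hl, by omega⟩) (h _)

/-- Rotations only enlarge `Dec`, and `Dec T` is disjoint from `Inc T`. Conversely, rotate the root
label of `T` to the root of `S`; this adds no `Dec` pair inside either branch, so both pairs of
branches stay compatible and induction applies. -/
theorem reflTransGen_iff_compat {S T : PTree} (hn : S.numNodes = T.numNodes) :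
    ReflTransGen Rotation S T ↔ Compat S T := by
  refine ⟨fun h i j hd => compat_self T i j (dec_mono h hd), fun h => ?_⟩
  induction T generalizing S with
  | nil =>
    cases S with
    | nil => exact .refl
    | node _ L R => simp at hn
  | node _ C D ihC ihD =>
    rw [numNodes_node] at hn
    -- Every smaller label lies in the left subtree of the root of `T`, so compatibility keeps that
    -- root label out of all right subtrees of `S`.
    obtain ⟨A, B, hA, hr, hdA, hdB⟩ := exists_le_node S C.numNodes (by omega) fun i hi =>
      h _ _ hi (inc_node_root.2 hi.bounds.1)
    have hn' := numNodes_eq_of_reflTransGen hr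
    rw [numNodes_node] at hn'
    refine hr.trans (reflTransGen_node (ihC hA ?_) (ihD (by omega) ?_))
    · exact fun i j hd hi => h i j (hdA i j hd) (Or.inl hi)
    · exact fun i j hd hi => h _ _ (hdB i j hd) (inc_node_add.2 hi)

theorem Tam.le_iff {n : ℕ} {S T : Tam n} : S ≤ T ↔ Compat S.tree T.tree :=
  reflTransGen_iff_compat (S.2.trans T.2.symm)

theorem Tam.ext_dec {n : ℕ} {S T : Tam n} (h : ∀ i j, Dec S.tree i j ↔ Dec T.tree i j) :
    S = T :=
  le_antisymm (Tam.le_iff.2 fun i j hd => compat_self _ i j ((h i j).1 hd))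
    (Tam.le_iff.2 fun i j hd => compat_self _ i j ((h i j).2 hd))

theorem Tam.ext_inc {n : ℕ} {S T : Tam n} (h : ∀ i j, Inc S.tree i j ↔ Inc T.tree i j) :
    S = T :=
  le_antisymm (Tam.le_iff.2 fun i j hd hi => compat_self _ i j hd ((h i j).2 hi))
    (Tam.le_iff.2 fun i j hd hi => compat_self _ i j hd ((h i j).1 hi))

/-! ### Trees with prescribed subtree relations -/

/-- The root must be the least label related to all later ones; the last label qualifies vacuously.
The relation then splits into the two sides. -/
theorem exists_tree_dec (n : ℕ) (D : ℕ → ℕ → Prop) (hD : ∀ i j, D i j → i < j ∧ j < n)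
    (trans : ∀ i j k, D i j → D j k → D i k) (of_lt : ∀ i j k, i < j → j < k → D i k → D i j) :
    ∃ T : PTree, T.numNodes = n ∧ ∀ i j, Dec T i j ↔ D i j := by
  classical
  induction n using Nat.strong_induction_on generalizing D with
  | _ n ih =>
    rcases Nat.eq_zero_or_pos n with rfl | hn
    · exact ⟨.nil, rfl, fun i j => ⟨False.elim, fun h => absurd (hD i j h).2 (Nat.not_lt_zero _)⟩⟩
    have hex : ∃ s, s < n ∧ ∀ j, s < j → j < n → D s j :=
      ⟨n - 1, by omega, fun j _ _ => by omega⟩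
    obtain ⟨s, ⟨hs, hsD⟩, hmin⟩ : ∃ s, (s < n ∧ ∀ j, s < j → j < n → D s j) ∧
        ∀ i < s, ¬ (i < n ∧ ∀ j, i < j → j < n → D i j) :=
      ⟨Nat.find hex, Nat.find_spec hex, fun i hi => Nat.find_min hex hi⟩
    -- A label before `s` reaching `s` or beyond would reach `s`, hence all later labels by
    -- transitivity, against minimality.
    have key : ∀ i j, i < s → D i j → j < s := by
      intro i j hi hij
      by_contra hj
      have his : D i s := by
        rcases eq_or_lt_of_le (not_lt.1 hj) with rfl | h
        · exact hij
        · exact of_lt _ _ _ hi h hij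
      refine hmin i hi ⟨by omega, fun k hk hkn => ?_⟩
      rcases lt_trichotomy k s with h | rfl | h
      · exact of_lt _ _ _ hk h his
      · exact his
      · exact trans _ _ _ his (hsD k h hkn)
    obtain ⟨L, hL, hLD⟩ := ih s hs (fun i j => D i j ∧ j < s)
      (fun i j h => ⟨(hD i j h.1).1, h.2⟩)
      (fun i j k h h' => ⟨trans _ _ _ h.1 h'.1, h'.2⟩)
      (fun i j k hij hjk h => ⟨of_lt _ _ _ hij hjk h.1, hjk.trans h.2⟩)
    obtain ⟨R, hR, hRD⟩ := ih (n - (s + 1)) (by omega) (fun i j => D (s + 1 + i) (s + 1 + j))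
      (fun i j h => by have := hD _ _ h; omega)
      (fun i j k h h' => trans _ _ _ h h')
      (fun i j k hij hjk h => of_lt _ _ _ (by omega) (by omega) h)
    refine ⟨.node () L R, by rw [numNodes_node]; omega, fun i j => ?_⟩
    rcases lt_trichotomy i s with h | rfl | h
    · rw [dec_node_of_lt (by omega), hLD]
      exact ⟨And.left, fun hd => ⟨hd, key i j h hd⟩⟩
    · nth_rw 1 [← hL]
      rw [dec_node_root]
      exact ⟨fun h => hsD j (by omega) (by omega), fun h => by have := hD _ _ h; omega⟩
    · obtain ⟨i, rfl⟩ := Nat.exists_eq_add_of_lt h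
      by_cases hj : s + 1 ≤ j
      · obtain ⟨j, rfl⟩ := Nat.exists_eq_add_of_le hj
        rw [show s + i + 1 = s + 1 + i by omega, ← hRD]
        nth_rw 1 [← hL, ← hL]
        exact dec_node_add
      · exact ⟨fun h => by have := h.bounds; omega, fun h => by have := hD _ _ h; omega⟩

/-- Mirror image of `exists_tree_dec`: the root is the greatest label to which all earlier ones are
related. -/
theorem exists_tree_inc (n : ℕ) (I : ℕ → ℕ → Prop) (hI : ∀ i j, I i j → i < j ∧ j < n)
    (trans : ∀ i j k, I i j → I j k → I i k) (of_lt : ∀ i j k, i < j → j < k → I i k → I j k) :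
    ∃ T : PTree, T.numNodes = n ∧ ∀ i j, Inc T i j ↔ I i j := by
  classical
  induction n using Nat.strong_induction_on generalizing I with
  | _ n ih =>
    rcases Nat.eq_zero_or_pos n with rfl | hn
    · exact ⟨.nil, rfl, fun i j => ⟨False.elim, fun h => absurd (hI i j h).2 (Nat.not_lt_zero _)⟩⟩
    obtain ⟨s, ⟨hs, hsI⟩, hmax⟩ : ∃ s, (s < n ∧ ∀ i < s, I i s) ∧
        ∀ j, s < j → ¬ (j < n ∧ ∀ i < j, I i j) := by
      have h0 : (0 : ℕ) < n ∧ ∀ i < 0, I i 0 := ⟨hn, fun i hi => absurd hi (Nat.not_lt_zero _)⟩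
      refine ⟨Nat.findGreatest (fun s => s < n ∧ ∀ i < s, I i s) n,
        Nat.findGreatest_spec (P := fun s => s < n ∧ ∀ i < s, I i s) (Nat.zero_le n) h0, ?_⟩
      exact fun j hj hP => Nat.findGreatest_is_greatest hj hP.1.le hP
    have key : ∀ i j, s < j → I i j → s < i := by
      intro i j hj hij
      by_contra hi
      have hsj : I s j := by
        rcases eq_or_lt_of_le (not_lt.1 hi) with rfl | h
        · exact hij
        · exact of_lt _ _ _ h hj hij
      refine hmax j hj ⟨(hI _ _ hij).2, fun k hk => ?_⟩
      rcases lt_trichotomy k s with h | rfl | h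
      · exact trans _ _ _ (hsI k h) hsj
      · exact hsj
      · exact of_lt _ _ _ h hk hsj
    obtain ⟨L, hL, hLI⟩ := ih s hs (fun i j => I i j ∧ j < s)
      (fun i j h => ⟨(hI i j h.1).1, h.2⟩)
      (fun i j k h h' => ⟨trans _ _ _ h.1 h'.1, h'.2⟩)
      (fun i j k hij hjk h => ⟨of_lt _ _ _ hij hjk h.1, h.2⟩)
    obtain ⟨R, hR, hRI⟩ := ih (n - (s + 1)) (by omega) (fun i j => I (s + 1 + i) (s + 1 + j))
      (fun i j h => by have := hI _ _ h; omega)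
      (fun i j k h h' => trans _ _ _ h h')
      (fun i j k hij hjk h => of_lt _ _ _ (by omega) (by omega) h)
    refine ⟨.node () L R, by rw [numNodes_node]; omega, fun i j => ?_⟩
    rcases lt_trichotomy j s with h | rfl | h
    · rw [inc_node_of_lt (by omega), hLI]
      exact ⟨And.left, fun hd => ⟨hd, h⟩⟩
    · nth_rw 1 [← hL]
      rw [inc_node_root]
      exact ⟨fun h => hsI i (by omega), fun h => by have := hI _ _ h; omega⟩
    · obtain ⟨j, rfl⟩ := Nat.exists_eq_add_of_lt h
      by_cases hi : s + 1 ≤ i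
      · obtain ⟨i, rfl⟩ := Nat.exists_eq_add_of_le hi
        rw [show s + j + 1 = s + 1 + j by omega, ← hRI]
        nth_rw 1 [← hL, ← hL]
        exact inc_node_add
      · refine ⟨fun h' => ?_, fun h' => absurd (key _ _ h h') (by omega)⟩
        rcases h' with h' | h' | h'
        · have := h'.bounds; omega
        · omega
        · omega

/-! ### Graftings as blocks of consecutive labels -/

section graft

variable {L R S : PTree} {a : ℕ}

theorem graft_node_of_le (h : a ≤ L.numNodes) :
    graft (.node () L R) (a + 1) S = .node () (graft L (a + 1) S) R := by
  rw [graft, if_pos (by omega)]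

theorem graft_node_add :
    graft (.node () L R) (L.numNodes + 1 + a + 1) S = .node () L (graft R (a + 1) S) := by
  rw [graft, if_neg (by omega), show L.numNodes + 1 + a + 1 - (L.numNodes + 1) = a + 1 by omega]

theorem numNodes_graft (T : PTree) (i : ℕ) (S : PTree) :
    (graft T i S).numNodes = T.numNodes + S.numNodes := by
  induction T generalizing i with
  | nil => simp [graft]
  | node _ L R ihL ihR =>
    rw [graft]
    split_ifs
    · rw [numNodes_node, numNodes_node, ihL]; omega
    · rw [numNodes_node, numNodes_node, ihR]; omega

/-- The vertex to the left of the grafting leaf has the grafted tree in its right subtree. -/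
theorem dec_graft_boundary (T S : PTree) (a : ℕ) (ha : a < T.numNodes) (hS : 0 < S.numNodes) :
    Dec (graft T (a + 1 + 1) S) a (a + S.numNodes) := by
  induction T generalizing a with
  | nil => exact absurd ha (Nat.not_lt_zero _)
  | node _ L R ihL ihR =>
    rw [numNodes_node] at ha
    rcases lt_trichotomy a L.numNodes with h | rfl | h
    · rw [graft_node_of_le (by omega)]
      exact Or.inl (ihL a h)
    · have e := graft_node_add (L := L) (R := R) (S := S) (a := 0)
      rw [Nat.add_zero] at e
      rw [e, dec_node_root, numNodes_graft]
      omega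
    · obtain ⟨a, rfl⟩ := Nat.exists_eq_add_of_le (Nat.succ_le_of_lt h)
      rw [show L.numNodes.succ + a + 1 + 1 = L.numNodes + 1 + (a + 1) + 1 by omega,
        graft_node_add, show L.numNodes.succ + a + S.numNodes =
          L.numNodes + 1 + (a + S.numNodes) by omega]
      exact dec_node_add.2 (ihR a (by omega))

/-- The vertex to the right of the grafting leaf has the grafted tree in its left subtree. -/
theorem inc_graft_boundary (T S : PTree) (a : ℕ) (ha : a < T.numNodes) (hS : 0 < S.numNodes) :
    Inc (graft T (a + 1) S) a (a + S.numNodes) := by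
  induction T generalizing a with
  | nil => exact absurd ha (Nat.not_lt_zero _)
  | node _ L R ihL ihR =>
    rw [numNodes_node] at ha
    rcases lt_trichotomy a L.numNodes with h | rfl | h
    · rw [graft_node_of_le (by omega)]
      exact Or.inl (ihL a h)
    · rw [graft_node_of_le le_rfl, ← numNodes_graft L (L.numNodes + 1) S, inc_node_root,
        numNodes_graft]
      omega
    · obtain ⟨a, rfl⟩ := Nat.exists_eq_add_of_le (Nat.succ_le_of_lt h)
      rw [show L.numNodes.succ + a + 1 = L.numNodes + 1 + a + 1 by omega,
        graft_node_add, show L.numNodes.succ + a + S.numNodes =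
          L.numNodes + 1 + (a + S.numNodes) by omega]
      exact inc_node_add.2 (ihR a (by omega))

theorem dec_graft_grafted (T S : PTree) (a : ℕ) (ha : a ≤ T.numNodes) {i j : ℕ}
    (h : Dec S i j) : Dec (graft T (a + 1) S) (a + i) (a + j) := by
  induction T generalizing a with
  | nil =>
    obtain rfl : a = 0 := Nat.le_zero.1 ha
    simpa [graft] using h
  | node _ L R ihL ihR =>
    rw [numNodes_node] at ha
    by_cases hl : a ≤ L.numNodes
    · rw [graft_node_of_le hl]
      exact Or.inl (ihL a hl)
    · obtain ⟨a, rfl⟩ := Nat.exists_eq_add_of_le (Nat.succ_le_of_lt (not_le.1 hl))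
      rw [Nat.succ_eq_add_one, graft_node_add, add_assoc _ a i, add_assoc _ a j]
      exact dec_node_add.2 (ihR a (by omega))

theorem inc_graft_grafted (T S : PTree) (a : ℕ) (ha : a ≤ T.numNodes) {i j : ℕ}
    (h : Inc S i j) : Inc (graft T (a + 1) S) (a + i) (a + j) := by
  induction T generalizing a with
  | nil =>
    obtain rfl : a = 0 := Nat.le_zero.1 ha
    simpa [graft] using h
  | node _ L R ihL ihR =>
    rw [numNodes_node] at ha
    by_cases hl : a ≤ L.numNodes
    · rw [graft_node_of_le hl]
      exact Or.inl (ihL a hl)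
    · obtain ⟨a, rfl⟩ := Nat.exists_eq_add_of_le (Nat.succ_le_of_lt (not_le.1 hl))
      rw [Nat.succ_eq_add_one, graft_node_add, add_assoc _ a i, add_assoc _ a j]
      exact inc_node_add.2 (ihR a (by omega))

/-- The label, after `m` vertices have been inserted before the vertex `a`, of the vertex `x`. -/
def relabel (a m x : ℕ) : ℕ := if x < a then x else x + m

theorem relabel_add (b a m x : ℕ) : relabel (b + a) m (b + x) = b + relabel a m x := by
  unfold relabel; split_ifs <;> omega

theorem dec_graft_base (T S : PTree) (a : ℕ) (ha : a ≤ T.numNodes) {i j : ℕ}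
    (h : Dec T i j) :
    Dec (graft T (a + 1) S) (relabel a S.numNodes i) (relabel a S.numNodes j) := by
  induction T generalizing a i j with
  | nil => exact h.elim
  | node _ L R ihL ihR =>
    rw [numNodes_node] at ha
    by_cases hl : a ≤ L.numNodes
    · rw [graft_node_of_le hl]
      have hn := numNodes_graft L (a + 1) S
      rcases h with h | ⟨rfl, h⟩ | ⟨h₁, h₂, h⟩
      · exact Or.inl (ihL a hl h)
      · refine Or.inr (Or.inl ?_)
        unfold relabel
        rw [if_neg (by omega), if_neg (by omega)]
        omega
      · unfold relabel
        rw [if_neg (by omega), if_neg (by omega)]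
        refine Or.inr (Or.inr ⟨by omega, by omega, ?_⟩)
        convert h using 1 <;> omega
    · obtain ⟨a, rfl⟩ := Nat.exists_eq_add_of_le (Nat.succ_le_of_lt (not_le.1 hl))
      rw [Nat.succ_eq_add_one, graft_node_add]
      rcases h with h | ⟨rfl, h⟩ | ⟨h₁, h₂, h⟩
      · have := h.bounds
        unfold relabel
        rw [if_pos (by omega), if_pos (by omega)]
        exact Or.inl h
      · refine Or.inr (Or.inl ?_)
        rw [numNodes_graft]
        unfold relabel
        rw [if_pos (by omega)]
        split_ifs <;> omega
      · obtain ⟨i, rfl⟩ := Nat.exists_eq_add_of_le (Nat.succ_le_of_lt h₁)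
        obtain ⟨j, rfl⟩ := Nat.exists_eq_add_of_le (Nat.succ_le_of_lt h₂)
        rw [Nat.succ_eq_add_one, Nat.add_sub_cancel_left, Nat.add_sub_cancel_left] at h
        rw [Nat.succ_eq_add_one, relabel_add, relabel_add]
        exact dec_node_add.2 (ihR a (by omega) h)

theorem inc_graft_base (T S : PTree) (a : ℕ) (ha : a ≤ T.numNodes) {i j : ℕ}
    (h : Inc T i j) :
    Inc (graft T (a + 1) S) (relabel a S.numNodes i) (relabel a S.numNodes j) := by
  induction T generalizing a i j with
  | nil => exact h.elim
  | node _ L R ihL ihR =>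
    rw [numNodes_node] at ha
    by_cases hl : a ≤ L.numNodes
    · rw [graft_node_of_le hl]
      have hn := numNodes_graft L (a + 1) S
      rcases h with h | ⟨h, rfl⟩ | ⟨h₁, h₂, h⟩
      · exact Or.inl (ihL a hl h)
      · refine Or.inr (Or.inl ?_)
        unfold relabel
        split_ifs <;> omega
      · unfold relabel
        rw [if_neg (by omega), if_neg (by omega)]
        refine Or.inr (Or.inr ⟨by omega, by omega, ?_⟩)
        convert h using 1 <;> omega
    · obtain ⟨a, rfl⟩ := Nat.exists_eq_add_of_le (Nat.succ_le_of_lt (not_le.1 hl))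
      rw [Nat.succ_eq_add_one, graft_node_add]
      rcases h with h | ⟨h, rfl⟩ | ⟨h₁, h₂, h⟩
      · have := h.bounds
        unfold relabel
        rw [if_pos (by omega), if_pos (by omega)]
        exact Or.inl h
      · refine Or.inr (Or.inl ?_)
        unfold relabel
        rw [if_pos (by omega), if_pos (by omega)]
        omega
      · obtain ⟨i, rfl⟩ := Nat.exists_eq_add_of_le (Nat.succ_le_of_lt h₁)
        obtain ⟨j, rfl⟩ := Nat.exists_eq_add_of_le (Nat.succ_le_of_lt h₂)
        rw [Nat.succ_eq_add_one, Nat.add_sub_cancel_left, Nat.add_sub_cancel_left] at h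
        rw [Nat.succ_eq_add_one, relabel_add, relabel_add]
        exact inc_node_add.2 (ihR a (by omega) h)

/-- Both components embed in the grafting by maps depending only on sizes, which agree for the lower
and upper trees; a common pair in a component would give one in the grafting. -/
theorem Compat.of_graft {S₁ S₂ T₁ T₂ : PTree} (ha : a ≤ S₁.numNodes)
    (h₁ : S₁.numNodes = T₁.numNodes) (h₂ : S₂.numNodes = T₂.numNodes)
    (h : Compat (graft S₁ (a + 1) S₂) (graft T₁ (a + 1) T₂)) :
    Compat S₁ T₁ ∧ Compat S₂ T₂ := by
  constructor
  · intro i j hd hi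
    refine h _ _ (dec_graft_base S₁ S₂ a ha hd) ?_
    rw [h₂]
    exact inc_graft_base T₁ T₂ a (h₁ ▸ ha) hi
  · intro i j hd hi
    exact h _ _ (dec_graft_grafted S₁ S₂ a ha hd) (inc_graft_grafted T₁ T₂ a (h₁ ▸ ha) hi)

/-- If the vertices `a, …, b` have right subtrees inside this block, and the vertex before `a`,
if any, has `b` in its right subtree, then the block is the set of vertices of a grafted tree. -/
theorem exists_eq_graft_of_dec (S : PTree) (a b : ℕ) (hab : a ≤ b) (hb : b < S.numNodes)
    (hl : ∀ x, x + 1 = a → Dec S x b) (hr : ∀ x, a ≤ x → x ≤ b → ¬ Dec S x (b + 1)) :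
    ∃ S₁ S₂ : PTree, S = graft S₁ (a + 1) S₂ ∧ a + S₂.numNodes = b + 1 ∧ a ≤ S₁.numNodes := by
  induction S generalizing a b with
  | nil => exact absurd hb (Nat.not_lt_zero _)
  | node _ L R ihL ihR =>
    rw [numNodes_node] at hb
    rcases lt_or_ge b L.numNodes with hbl | hbl
    · obtain ⟨S₁, S₂, rfl, hc, ha⟩ := ihL a b hab hbl
        (fun x hx => (dec_node_of_lt (by omega)).1 (hl x hx))
        (fun x hx hx' h => hr x hx hx' (Or.inl h))
      exact ⟨.node () S₁ R, S₂, (graft_node_of_le ha).symm, hc, by rw [numNodes_node]; omega⟩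
    · rcases le_or_gt a L.numNodes with hal | hal
      -- The root is in the block. Its right subtree contains all later labels, so the block ends at
      -- the last one; a label before `a` would be in `L`, its right subtree too, and could not
      -- reach `b`. The block is the whole tree.
      · have hb' : ¬ b < L.numNodes + R.numNodes := fun h =>
          hr _ hal hbl (dec_node_root.2 ⟨by omega, by omega⟩)
        obtain rfl : a = 0 := by
          by_contra ha
          have := hl (a - 1) (by omega)
          rw [dec_node_of_lt (by omega)] at this
          have := this.bounds
          omega
        refine ⟨.nil, .node () L R, rfl, ?_, Nat.zero_le _⟩
        rw [numNodes_node]; omega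
      · obtain ⟨a, rfl⟩ := Nat.exists_eq_add_of_le (Nat.succ_le_of_lt hal)
        obtain ⟨b, rfl⟩ := Nat.exists_eq_add_of_le ((Nat.le_add_right _ a).trans hab)
        rw [Nat.succ_eq_add_one] at *
        obtain ⟨S₁, S₂, rfl, hc, ha⟩ := ihR a b (by omega) (by omega)
          (fun x hx => dec_node_add.1 (hl (L.numNodes + 1 + x) (by omega)))
          (fun x hx hx' h => hr (L.numNodes + 1 + x) (by omega) (by omega) (dec_node_add.2 h))
        exact ⟨.node () L S₁, S₂, graft_node_add.symm, by omega, by rw [numNodes_node]; omega⟩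

/-- If the vertices `a, …, b` have left subtrees inside this block, and the vertex after `b`,
if any, has `a` in its left subtree, then the block is the set of vertices of a grafted tree. -/
theorem exists_eq_graft_of_inc (T : PTree) (a b : ℕ) (hab : a ≤ b) (hb : b < T.numNodes)
    (hr : b + 1 < T.numNodes → Inc T a (b + 1))
    (hl : ∀ x y, x + 1 = a → a ≤ y → y ≤ b → ¬ Inc T x y) :
    ∃ T₁ T₂ : PTree, T = graft T₁ (a + 1) T₂ ∧ a + T₂.numNodes = b + 1 ∧ a ≤ T₁.numNodes := by
  induction T generalizing a b with
  | nil => exact absurd hb (Nat.not_lt_zero _)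
  | node _ L R ihL ihR =>
    rw [numNodes_node] at hb hr
    rcases lt_or_ge b L.numNodes with hbl | hbl
    · obtain ⟨T₁, T₂, rfl, hc, ha⟩ := ihL a b hab hbl
        (fun h => (inc_node_of_lt h).1 (hr (by omega)))
        (fun x y hx hy hy' h => hl x y hx hy hy' (Or.inl h))
      exact ⟨.node () T₁ R, T₂, (graft_node_of_le ha).symm, hc, by rw [numNodes_node]; omega⟩
    · rcases le_or_gt a L.numNodes with hal | hal
      -- The root is in the block, and all earlier labels are in its left subtree, so `a` is the
      -- first label. A label after the block would be in `R` and could not have `a` in its left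
      -- subtree.
      · obtain rfl : a = 0 := by
          by_contra ha
          exact hl (a - 1) _ (by omega) hal hbl (inc_node_root.2 (by omega))
        have hb' : ¬ b + 1 < L.numNodes + R.numNodes + 1 := by
          intro h
          rcases hr h with h | h | h
          · have := h.bounds; omega
          · omega
          · omega
        refine ⟨.nil, .node () L R, rfl, ?_, Nat.zero_le _⟩
        rw [numNodes_node]; omega
      · obtain ⟨a, rfl⟩ := Nat.exists_eq_add_of_le (Nat.succ_le_of_lt hal)
        obtain ⟨b, rfl⟩ := Nat.exists_eq_add_of_le ((Nat.le_add_right _ a).trans hab)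
        rw [Nat.succ_eq_add_one] at *
        obtain ⟨T₁, T₂, rfl, hc, ha⟩ := ihR a b (by omega) (by omega)
          (fun h => inc_node_add.1 (hr (by omega)))
          (fun x y hx hy hy' h => hl (L.numNodes + 1 + x) (L.numNodes + 1 + y) (by omega)
            (by omega) (by omega) (inc_node_add.2 h))
        exact ⟨.node () L T₁, T₂, graft_node_add.symm, by omega, by rw [numNodes_node]; omega⟩

end graft

/-! ### Characterization of new intervals -/

variable {n : ℕ}

/-- The lower tree is cut using `Dec` alone and the upper one using `Inc` alone, along the same
block. `hproper` makes the base of the grafting nonempty. -/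
theorem not_isNew_of_block (I : NonemptyInterval (Tam (n + 1))) (a b : ℕ) (hab : a ≤ b)
    (hb : b ≤ n) (hproper : 0 < a ∨ b < n)
    (hdl : ∀ x, x + 1 = a → Dec I.fst.tree x b)
    (hdr : ∀ x, a ≤ x → x ≤ b → ¬ Dec I.fst.tree x (b + 1))
    (hir : b < n → Inc I.snd.tree a (b + 1))
    (hil : ∀ x y, x + 1 = a → a ≤ y → y ≤ b → ¬ Inc I.snd.tree x y) : ¬ IsNew I := by
  have hSn : I.fst.tree.numNodes = n + 1 := I.fst.2
  have hTn : I.snd.tree.numNodes = n + 1 := I.snd.2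
  have hc : Compat I.fst.tree I.snd.tree := Tam.le_iff.1 I.fst_le_snd
  obtain ⟨S₁, S₂, hS, hS₂, hSa⟩ := exists_eq_graft_of_dec _ a b hab (by omega) hdl hdr
  obtain ⟨T₁, T₂, hT, hT₂, hTa⟩ := exists_eq_graft_of_inc _ a b hab (by omega)
    (fun h => hir (by omega)) hil
  rw [hS, numNodes_graft] at hSn
  rw [hT, numNodes_graft] at hTn
  rw [hS, hT] at hc
  obtain ⟨h₁, h₂⟩ := hc.of_graft hSa (by omega) (by omega)
  refine not_not.2 ⟨S₁.numNodes, S₂.numNodes,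
    ⟨(⟨S₁, rfl⟩, ⟨T₁, by omega⟩), Tam.le_iff.2 h₁⟩, ⟨(⟨S₂, rfl⟩, ⟨T₂, by omega⟩), Tam.le_iff.2 h₂⟩,
    a + 1, by omega, by omega, by omega, by omega, hS, hT⟩

/-- The three clauses exclude final, initial and interior blocks respectively. Only the relations
with the neighbours of the block need to be required: compatibility and convexity supply the other
hypotheses of `not_isNew_of_block`. -/
theorem isNew_iff (I : NonemptyInterval (Tam (n + 1))) :
    IsNew I ↔ (∀ i, ¬ Dec I.fst.tree i n) ∧ (∀ j, ¬ Inc I.snd.tree 0 j) ∧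
      ∀ i j, Dec I.fst.tree i j → ¬ Inc I.snd.tree (i + 1) (j + 1) := by
  have hSn : I.fst.tree.numNodes = n + 1 := I.fst.2
  have hTn : I.snd.tree.numNodes = n + 1 := I.snd.2
  have hc : Compat I.fst.tree I.snd.tree := Tam.le_iff.1 I.fst_le_snd
  constructor
  · intro h
    refine ⟨fun i hd => ?_, fun j hi => ?_, fun i j hd hi => ?_⟩
    · have hin := hd.bounds
      refine not_isNew_of_block I (i + 1) n (by omega) le_rfl (by omega) ?_ ?_ (by omega) ?_ h
      · rintro x hx
        obtain rfl : x = i := by omega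
        exact hd
      · intro x _ _ hx
        have := hx.bounds; omega
      · intro x y hx hy hy'
        obtain rfl : x = i := by omega
        exact hc _ _ (hd.of_le (by omega) hy')
    · have hj := hi.bounds
      obtain ⟨b, rfl⟩ : ∃ b, j = b + 1 := ⟨j - 1, by omega⟩
      refine not_isNew_of_block I 0 b (by omega) (by omega) (by omega) (by omega) ?_
        (fun _ => hi) (by omega) h
      exact fun x _ hx hd => hc _ _ hd (hi.of_le (by omega) (by omega))
    · have hij := hd.bounds
      have hj := hi.bounds
      refine not_isNew_of_block I (i + 1) j (by omega) (by omega) (by omega) ?_ ?_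
        (fun _ => hi) ?_ h
      · rintro x hx
        obtain rfl : x = i := by omega
        exact hd
      · exact fun x hx hx' hd => hc _ _ hd (hi.of_le hx (by omega))
      · intro x y hx hy hy'
        obtain rfl : x = i := by omega
        exact hc _ _ (hd.of_le (by omega) hy')
  · rintro ⟨h₁, h₂, h₃⟩ ⟨k, m, J, K, i, hk, hm, hi, hik, hS, hT⟩
    have hJS : J.fst.tree.numNodes = k := J.fst.2
    have hJT : J.snd.tree.numNodes = k := J.snd.2
    have hKS : K.fst.tree.numNodes = m := K.fst.2
    have hKT : K.snd.tree.numNodes = m := K.snd.2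
    obtain ⟨a, rfl⟩ : ∃ a, i = a + 1 := ⟨i - 1, by omega⟩
    have hd : ∀ x, x + 1 = a → Dec I.fst.tree x (x + m) := by
      rintro x rfl
      rw [hS]
      convert dec_graft_boundary J.fst.tree K.fst.tree x (by omega) (by omega)
      exact hKS.symm
    have hi : a < k → Inc I.snd.tree a (a + m) := by
      intro h
      rw [hT]
      convert inc_graft_boundary J.snd.tree K.snd.tree a (by omega) (by omega)
      exact hKT.symm
    have hkm : k + m = n + 1 := by
      rw [hS, numNodes_graft, hJS, hKS] at hSn
      exact hSn
    rcases Nat.eq_zero_or_pos a with rfl | ha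
    · exact h₂ _ (hi (by omega))
    · obtain ⟨x, rfl⟩ : ∃ x, a = x + 1 := ⟨a - 1, by omega⟩
      rcases (show x + 1 = k ∨ x + 1 < k by omega) with h | h
      · refine h₁ x ?_
        convert hd x rfl using 1
        omega
      · refine h₃ _ _ (hd x rfl) ?_
        rw [show x + m + 1 = x + 1 + m by omega]
        exact hi h

/-! ### The bijection with modern interval-posets -/

/-- The modern interval-poset of a new interval: it has the relations of the right subtrees of
the lower tree, and those of the left subtrees of the upper tree, the latter shifted by one. -/
def modernPoset (I : NonemptyInterval (Tam (n + 1))) (h : IsNew I) : IntervalPoset n where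
  rel x y := x = y ∨ Dec I.fst.tree y x ∨ Inc I.snd.tree (x + 1) (y + 1)
  rel_refl _ := Or.inl rfl
  rel_antisymm a b := by
    have h₃ := ((isNew_iff I).1 h).2.2
    rintro (hab | hab | hab) (hba | hba | hba)
    · exact hab
    · exact hab
    · exact hab
    · exact hba.symm
    · have := hab.bounds; have := hba.bounds; omega
    · exact absurd hba (h₃ _ _ hab)
    · exact hba.symm
    · exact absurd hab (h₃ _ _ hba)
    · have := hab.bounds; have := hba.bounds; omega
  rel_trans a b c := by
    have h₃ := ((isNew_iff I).1 h).2.2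
    rintro (rfl | hab | hab) (rfl | hbc | hbc)
    · exact Or.inl rfl
    · exact Or.inr (Or.inl hbc)
    · exact Or.inr (Or.inr hbc)
    · exact Or.inr (Or.inl hab)
    · exact Or.inr (Or.inl (hbc.trans hab))
    -- In a mixed composition, convexity shortens one of the two relations to the pair `a`, `c`, or
    -- else produces a pair forbidden by `h₃`.
    · rcases lt_trichotomy a.1 c.1 with hac | hac | hac
      · exact Or.inr (Or.inr (hbc.of_le (by have := hab.bounds; omega) (by omega)))
      · exact Or.inl (Fin.ext hac)
      · exact absurd hbc (h₃ _ _ (hab.of_le (by have := hbc.bounds; omega) hac.le))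
    · exact Or.inr (Or.inr hab)
    · rcases lt_trichotomy a.1 c.1 with hac | hac | hac
      · exact absurd (hab.of_le (by omega) (by have := hbc.bounds; omega)) (h₃ _ _ hbc)
      · exact Or.inl (Fin.ext hac)
      · exact Or.inr (Or.inl (hbc.of_le hac (by have := hab.bounds; omega)))
    · exact Or.inr (Or.inr (hab.trans hbc))
  inc_condition a b c hab hbc := by
    rw [Fin.lt_def] at hab hbc
    rintro (rfl | h | h)
    · omega
    · have := h.bounds; omega
    · exact Or.inr (Or.inr (h.of_le (by omega) (by omega)))
  dec_condition a b c hab hbc := by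
    rw [Fin.lt_def] at hab hbc
    rintro (rfl | h | h)
    · omega
    · exact Or.inr (Or.inl (h.of_le (by omega) (by omega)))
    · have := h.bounds; omega

theorem modernPoset_rel_of_lt {I : NonemptyInterval (Tam (n + 1))} {h : IsNew I} {x y : Fin n}
    (hxy : x < y) : (modernPoset I h).rel x y ↔ Inc I.snd.tree (x + 1) (y + 1) := by
  constructor
  · rintro (rfl | hd | hi)
    · exact absurd hxy (lt_irrefl _)
    · exact absurd hd.bounds.1 (lt_asymm hxy)
    · exact hi
  · exact fun hi => Or.inr (Or.inr hi)

theorem modernPoset_rel_of_gt {I : NonemptyInterval (Tam (n + 1))} {h : IsNew I} {x y : Fin n}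
    (hxy : x < y) : (modernPoset I h).rel y x ↔ Dec I.fst.tree x y := by
  constructor
  · rintro (rfl | hd | hi)
    · exact absurd hxy (lt_irrefl _)
    · exact hd
    · have := hi.bounds; rw [Fin.lt_def] at hxy; omega
  · exact fun hd => Or.inr (Or.inl hd)

/-- A forbidden pattern at `y` shortens to the pair `(y, y + 1)` in both `Dec` of the lower tree and
`Inc` of the upper one. -/
theorem modernPoset_isModern (I : NonemptyInterval (Tam (n + 1))) (h : IsNew I) :
    (modernPoset I h).IsModern := by
  rintro ⟨x, y, z, hxy, hyz, h₁, h₂⟩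
  rw [modernPoset_rel_of_lt hxy] at h₁
  rw [modernPoset_rel_of_gt hyz] at h₂
  rw [Fin.lt_def] at hxy hyz
  exact Tam.le_iff.1 I.fst_le_snd y (y + 1) (h₂.of_le (by omega) (by omega))
    (h₁.of_le (by omega) (by omega))

theorem modernPoset_injective {I J : NonemptyInterval (Tam (n + 1))} (hI : IsNew I)
    (hJ : IsNew J) (h : modernPoset I hI = modernPoset J hJ) : I = J := by
  have hd : ∀ {I J : NonemptyInterval (Tam (n + 1))} (hI : IsNew I) (hJ : IsNew J),
      modernPoset I hI = modernPoset J hJ → ∀ i j, Dec I.fst.tree i j → Dec J.fst.tree i j := by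
    intro I J hI hJ h i j hd
    have hb := hd.bounds
    rw [show I.fst.tree.numNodes = n + 1 from I.fst.2] at hb
    -- Newness ensures that no `Dec` pair is lost by restricting to `Fin n`.
    have hj : j ≠ n := by
      rintro rfl
      exact ((isNew_iff I).1 hI).1 _ hd
    have hlt : (⟨i, by omega⟩ : Fin n) < ⟨j, by omega⟩ := hb.1
    have := (modernPoset_rel_of_gt (h := hI) hlt).2 hd
    rw [h] at this
    exact (modernPoset_rel_of_gt hlt).1 this
  have hi : ∀ {I J : NonemptyInterval (Tam (n + 1))} (hI : IsNew I) (hJ : IsNew J),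
      modernPoset I hI = modernPoset J hJ → ∀ i j, Inc I.snd.tree i j → Inc J.snd.tree i j := by
    intro I J hI hJ h i j hi
    have hb := hi.bounds
    rw [show I.snd.tree.numNodes = n + 1 from I.snd.2] at hb
    rcases i with _ | i
    · exact absurd hi (((isNew_iff I).1 hI).2.1 _)
    rcases j with _ | j
    · omega
    have hlt : (⟨i, by omega⟩ : Fin n) < ⟨j, by omega⟩ := by rw [Fin.lt_def]; simp only; omega
    have := (modernPoset_rel_of_lt (h := hI) hlt).2 hi
    rw [h] at this
    exact (modernPoset_rel_of_lt hlt).1 this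
  refine NonemptyInterval.ext (Prod.ext ?_ ?_)
  · exact Tam.ext_dec fun i j => ⟨hd hI hJ h i j, hd hJ hI h.symm i j⟩
  · exact Tam.ext_inc fun i j => ⟨hi hI hJ h i j, hi hJ hI h.symm i j⟩

theorem exists_modernPoset_eq (P : IntervalPoset n) (hP : P.IsModern) :
    ∃ (I : NonemptyInterval (Tam (n + 1))) (h : IsNew I), modernPoset I h = P := by
  obtain ⟨S, hSn, hS⟩ := exists_tree_dec (n + 1)
    (fun i j => ∃ x y : Fin n, x.1 = i ∧ y.1 = j ∧ x < y ∧ P.rel y x)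
    (by
      rintro _ _ ⟨x, y, rfl, rfl, hxy, -⟩
      exact ⟨hxy, by omega⟩)
    (by
      rintro _ _ _ ⟨x, y, rfl, rfl, hxy, h⟩ ⟨y', z, hy, rfl, hyz, h'⟩
      obtain rfl := Fin.ext hy
      exact ⟨x, z, rfl, rfl, hxy.trans hyz, P.rel_trans _ _ _ h' h⟩)
    (by
      rintro _ j _ hij hjk ⟨x, z, rfl, rfl, hxz, h⟩
      have hy : x < (⟨j, by omega⟩ : Fin n) := hij
      exact ⟨x, _, rfl, rfl, hy, P.dec_condition _ _ _ hy hjk h⟩)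
  obtain ⟨T, hTn, hT⟩ := exists_tree_inc (n + 1)
    (fun i j => ∃ x y : Fin n, x.1 + 1 = i ∧ y.1 + 1 = j ∧ x < y ∧ P.rel x y)
    (by
      rintro _ _ ⟨x, y, rfl, rfl, hxy, -⟩
      rw [Fin.lt_def] at hxy
      exact ⟨by omega, by omega⟩)
    (by
      rintro _ _ _ ⟨x, y, rfl, rfl, hxy, h⟩ ⟨y', z, hy, rfl, hyz, h'⟩
      obtain rfl : y' = y := Fin.ext (by omega)
      exact ⟨x, z, rfl, rfl, hxy.trans hyz, P.rel_trans _ _ _ h h'⟩)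
    (by
      rintro _ j _ hij hjk ⟨x, z, rfl, rfl, hxz, h⟩
      obtain ⟨j, rfl⟩ : ∃ y, j = y + 1 := ⟨j - 1, by omega⟩
      have hy : x < (⟨j, by omega⟩ : Fin n) := Nat.lt_of_succ_lt_succ hij
      have hz : (⟨j, by omega⟩ : Fin n) < z := Nat.lt_of_succ_lt_succ hjk
      exact ⟨_, z, rfl, rfl, hz, P.inc_condition _ _ _ hy hz h⟩)
  have hc : Compat S T := by
    intro i j hd hi
    obtain ⟨x, z, rfl, rfl, hxz, h⟩ := (hS _ _).1 hd
    obtain ⟨u, v, hu, hv, huv, h'⟩ := (hT _ _).1 hi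
    rw [Fin.lt_def] at hxz huv
    -- The shift gives `u < x ≤ v < z`. If `x = v` this is the forbidden pattern; otherwise the
    -- interval-poset conditions relate `x` and `v` both ways.
    have hux : u < x := by rw [Fin.lt_def]; omega
    have hvz : v < z := by rw [Fin.lt_def]; omega
    rcases eq_or_lt_of_le (show x.1 ≤ v.1 by omega) with hxv | hxv
    · obtain rfl := Fin.ext hxv
      exact hP ⟨u, x, z, hux, hxz, h', h⟩
    · have h₁ := P.inc_condition _ _ _ hux hxv h'
      have h₂ := P.dec_condition _ _ _ hxv hvz h
      exact absurd (P.rel_antisymm _ _ h₁ h₂) (Fin.ne_of_lt hxv)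
  let I : NonemptyInterval (Tam (n + 1)) :=
    ⟨(⟨S, hSn⟩, ⟨T, hTn⟩), Tam.le_iff.2 hc⟩
  have hI : IsNew I := by
    refine (isNew_iff I).2 ⟨fun i hd => ?_, fun j hi => ?_, fun i j hd hi => ?_⟩
    · obtain ⟨x, y, -, hy, -⟩ := (hS _ _).1 hd
      omega
    · obtain ⟨x, y, hx, -⟩ := (hT _ _).1 hi
      omega
    · obtain ⟨x, y, rfl, rfl, hxy, h⟩ := (hS _ _).1 hd
      obtain ⟨u, v, hu, hv, -, h'⟩ := (hT _ _).1 hi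
      obtain rfl : u = x := Fin.ext (by omega)
      obtain rfl : v = y := Fin.ext (by omega)
      exact absurd (P.rel_antisymm _ _ h' h) (Fin.ne_of_lt hxy)
  refine ⟨I, hI, IntervalPoset.ext ?_⟩
  funext x y
  apply propext
  rcases lt_trichotomy x y with h | rfl | h
  · rw [modernPoset_rel_of_lt h]
    refine (hT _ _).trans ⟨?_, fun hr => ⟨x, y, rfl, rfl, h, hr⟩⟩
    rintro ⟨u, v, hu, hv, -, hr⟩
    obtain rfl : u = x := Fin.ext (by omega)
    obtain rfl : v = y := Fin.ext (by omega)
    exact hr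
  · exact iff_of_true (IntervalPoset.rel_refl _ _) (P.rel_refl _)
  · rw [modernPoset_rel_of_gt h]
    refine (hS _ _).trans ⟨?_, fun hr => ⟨y, x, rfl, rfl, h, hr⟩⟩
    rintro ⟨u, v, hu, hv, -, hr⟩
    obtain rfl := Fin.ext hu
    obtain rfl := Fin.ext hv
    exact hr

end TamariNew

theorem mainTheorem4 (n : ℕ) :
    Nonempty ({I : NonemptyInterval (TamariNew.Tam (n + 1)) // TamariNew.IsNew I} ≃
      {P : TamariNew.IntervalPoset n // P.IsModern}) := by
  refine ⟨Equiv.ofBijective (fun I => ⟨TamariNew.modernPoset I.1 I.2,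
    TamariNew.modernPoset_isModern I.1 I.2⟩) ⟨fun I J h => ?_, fun P => ?_⟩⟩
  · exact Subtype.ext (TamariNew.modernPoset_injective I.2 J.2 (congrArg Subtype.val h))
  · obtain ⟨I, hI, h⟩ := TamariNew.exists_modernPoset_eq P.1 P.2
    exact ⟨⟨I, hI⟩, Subtype.ext h⟩
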